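/- \textbf{Setting.} Let $X=\mathbf{Z}\times[0,1]^{\mathbf{N}}$ with the product $\lambda$ of the counting measure and of the Lebesgue measure on the Hilbert cube. A \emph{non-singular} map is a measurable $f:X\to X$ such that $\lambda(f(A))=0\Leftrightarrow\lambda(A)=0$ for all measurable $A$. A \emph{microcosm} is a set of non-singular maps that contains the identity and is closed under composition. A map $f$ is \emph{compilable} in a set $N$ of maps if there are a finite measurable partition $X_1,\dots,X_k$ of $X$ and $n_1,\dots,n_k\in N$ with $f=n_i$ almost everywhere on $X_i$ for each $i$. For microcosms, $\mathfrak m\prec_c\mathfrak n$ means that each $f\in\mathfrak m$ is compilable in $\mathfrak n$, and $\mathfrak m\sim_c\mathfrak n$ means $\mathfrak m\prec_c\mathfrak n$ and $\mathfrak n\prec_c\mathfrak m$. \textbf{Graphings.} Let $\Omega$ be a monoid. An $\Omega$-weighted graphing $F$ of measurable carrier $V\subseteq X$ consists of a finite non-empty set $D^F$ of states (the dialect) and a countable family of edges $e$, each with a weight $\omega_e\in\Omega$, a measurable source $S_e\subseteq V$, a realisation $\phi_e$, which is the restriction to $S_e$ of a non-singular map, with $\lambda$-measurable target $\phi_e(S_e)\subseteq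 V$, and an initial and a final state. It is a graphing \emph{in} $\mathfrak m$ if each $\phi_e$ is the restriction of an element of $\mathfrak m$. The kind $\kappa$ of graphings is one of: all graphings; non-deterministic (all weights lie in $\{0,1\}$); deterministic (moreover, almost no point lies, in the same state, in the sources of two distinct edges); probabilistic (if $[0,1]$ is a submonoid of $\Omega$: all weights lie in $[0,1]$, and at almost every point and each state the weights of the edges that leave it have sum $\le 1$). The \emph{execution} $F{::}G$ of graphings of carriers $V,W$ has carrier $V\triangle W$ and dialect $D^F\times D^G$. Its edges are the alternating paths of edges of $F$ and $G$ (an edge of one leaves the state of the other unchanged), realised by composition, weighted by the product of the weights, and restricted to the points where they start and end outside of $V\cap W$. Fix a map $m:\Omega\to[0,\infty]$. The \emph{measurement} is $$[\![F,G]\!]=\frac{1}{|D^F||D^G|}\sum_{l}\frac{m(\omega(l))}{|l|}\,\lambda(C_l),$$ where $l$ runs over the alternating cycles with a base point, $|l|$ is the length of $l$, and $C_l$ is the set of the points $x$ whose orbit along $l$ is defined and closes up at $x$, without being the repetition of a shorter closed orbit along a cycle of which $l$ is a power. \textbf{Projects and types.} A \emph{project} $\mathfrak a=(a,\sum_i\alpha_iA_i)$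 consists of a wager $a\in\mathbf{R}\cup\{\infty\}$ and a finite family of graphings $A_i$ of the same carrier with coefficients $\alpha_i\in\mathbf{R}$. It is of kind $\kappa$, or in $\mathfrak m$, if all $A_i$ are. Put $1_{\mathfrak a}=\sum_i\alpha_i$ and $\langle\!\langle\mathfrak a,\mathfrak b\rangle\!\rangle=a1_{\mathfrak b}+b1_{\mathfrak a}+\sum_{i,j}\alpha_i\beta_j[\![A_i,B_j]\!]$, computed in $\mathbf{R}\cup\{\infty\}$ with $0\cdot\infty=0$ and $c\cdot\infty=\infty$ for $c\ne0$. Write $\mathfrak a\perp\mathfrak b$ if the carriers agree and $\langle\!\langle\mathfrak a,\mathfrak b\rangle\!\rangle\neq0,\infty$. The execution of projects is $\mathfrak a{::}\mathfrak b=(\langle\!\langle\mathfrak a,\mathfrak b\rangle\!\rangle,\sum_{i,j}\alpha_i\beta_jA_i{::}B_j)$. A \emph{type} of carrier $V$ is a set of projects of kind $\kappa$ and carrier $V$ that equals its bi-orthogonal, where orthogonals are taken among all projects of kind $\kappa$ and carrier $V$. For types $A,B$ of disjoint carriers $V,W$, $A\multimap B$ is the set of the projects $\mathfrak f$ of kind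 $\kappa$ and carrier $V\cup W$ with $\mathfrak f{::}\mathfrak a\in B$ for all $\mathfrak a\in A$. \textbf{Words.} Let $\Sigma$ be a finite alphabet and place the vertices $v\in(\Sigma\cup\{\star\})\times\{\mathrm{in},\mathrm{out}\}$ at distinct integers $c(v)$. For a word $w$ let $s_0=\star,s_1,\dots,s_{N-1}$ be the list $\star w$. The word is represented by the project $!L_w$ of wager $0$ with a single slice of coefficient $1$, a graphing with one state and weights $1$ whose edges link, in both directions and for each $i$ modulo $N$, the set $\{c(s_i,\mathrm{out})\}\times[\frac iN,\frac{i+1}N)\times[0,1]^{\mathbf{N}}$ with $\{c(s_{i+1},\mathrm{in})\}\times[\frac{i+1}N,\frac{i+2}N)\times[0,1]^{\mathbf{N}}$ (the index $i+1$ being reduced modulo $N$), by translation. The type $!\mathbf{List}$ is the bi-orthogonal of $\{!L_w\}_w$; its carrier consists of the points whose integer coordinate is some $c(v)$. Let $\mathbf{B}$ be any type (in the role of the type of non-deterministic booleans) whose carrier is disjoint from that of $!\mathbf{List}$. Let $T$ be a test, that is, a family of projects, and put $[P]_T=\{w : P{::}!L_w\perp t\text{ for all }t\in T\}$. For a microcosm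 $\mathfrak m$ let $$\mathtt C[\mathfrak m]=\{[P]_T : P\in{!\mathbf{List}}\multimap\mathbf{B},\ P\text{ in }\mathfrak m\}.$$ \textbf{Theorem.} Fix $\Omega$, $m$, $\kappa$, $\Sigma$, $c$, $\mathbf{B}$ and $T$ as above, and let $\mathfrak m,\mathfrak n$ be microcosms. If $\mathfrak m\prec_c\mathfrak n$, then $\mathtt C[\mathfrak m]\subseteq\mathtt C[\mathfrak n]$. Hence, if $\mathfrak m\sim_c\mathfrak n$, then $\mathtt C[\mathfrak m]=\mathtt C[\mathfrak n]$. -/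

import Mathlib

open MeasureTheory Set
open scoped ENNReal NNReal

universe u

namespace Microcosmos

noncomputable section

/-! ## Non-singular maps, microcosms, compilation -/

/-- A non-singular transformation: a measurable map `f` with `μ (f A) = 0 ↔ μ A = 0`. -/
def Nonsingular {X : Type*} [MeasurableSpace X] (μ : Measure X) (f : X → X) : Prop :=
  Measurable f ∧ ∀ A, MeasurableSet A → (μ (f '' A) = 0 ↔ μ A = 0)

theorem Nonsingular.image_null_iff {X : Type*} [MeasurableSpace X] {μ : Measure X} {f : X → X}
    (hf : Nonsingular μ f) (A : Set X) : μ (f '' A) = 0 ↔ μ A = 0 := by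
  constructor
  · intro h
    obtain ⟨N, hAN, hN, hN0⟩ := exists_measurable_superset_of_null h
    have h1 : MeasurableSet (f ⁻¹' N) := hf.1 hN
    have h2 : μ (f '' (f ⁻¹' N)) = 0 := measure_mono_null (image_preimage_subset f N) hN0
    exact measure_mono_null (image_subset_iff.1 hAN) ((hf.2 _ h1).1 h2)
  · intro h
    obtain ⟨N, hAN, hN, hN0⟩ := exists_measurable_superset_of_null h
    exact measure_mono_null (image_mono hAN) ((hf.2 _ hN).2 hN0)

theorem Nonsingular.id {X : Type*} [MeasurableSpace X] (μ : Measure X) :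
    Nonsingular μ (fun x : X => x) :=
  ⟨measurable_id, fun A _ => by simp⟩

theorem Nonsingular.comp {X : Type*} [MeasurableSpace X] {μ : Measure X} {f g : X → X}
    (hf : Nonsingular μ f) (hg : Nonsingular μ g) : Nonsingular μ (f ∘ g) :=
  ⟨hf.1.comp hg.1, fun A _ => by
    rw [image_comp, hf.image_null_iff, hg.image_null_iff]⟩

theorem exists_measurableSet_image {α β : Type*} [MeasurableSpace α] [StandardBorelSpace α]
    [TopologicalSpace β] [T2Space β] [SecondCountableTopology β]
    [MeasurableSpace β] [OpensMeasurableSpace β] (ν : Measure α) [IsFiniteMeasure ν]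
    {f : α → β} (hf : Measurable f) {S : Set α} (hS : MeasurableSet S) :
    ∃ K, K ⊆ S ∧ ν (S \ K) = 0 ∧ MeasurableSet (f '' K) := by
  let _ := upgradeStandardBorel α
  let t₀ : TopologicalSpace α := inferInstance
  have hpol₀ : @PolishSpace α t₀ := inferInstance
  obtain ⟨t', ht', hfc, hpol⟩ := hf.exists_continuous
  have hb : @BorelSpace α t' _ := by
    refine @BorelSpace.mk _ _ _ ?_
    rw [eq_borel_upgradeStandardBorel α]
    exact (borel_eq_borel_of_le hpol hpol₀ ht').symm
  have key : ∀ n : ℕ, ∃ K, K ⊆ S ∧ @IsCompact α t' K ∧ ν (S \ K) < (n + 1 : ℝ≥0∞)⁻¹ := by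
    intro n
    let _ := t'
    exact hS.exists_isCompact_sdiff_lt (measure_ne_top ν S) (by simp)
  choose K hKS hK hKν using key
  refine ⟨⋃ n, K n, iUnion_subset hKS, ?_, ?_⟩
  · refine le_antisymm (ge_of_tendsto' (ENNReal.tendsto_inv_nat_nhds_zero.comp
      (Filter.tendsto_add_atTop_nat 1)) fun n => ?_) bot_le
    refine (measure_mono (sdiff_subset_sdiff_right (subset_iUnion K n))).trans (hKν n).le |>.trans ?_
    simp
  · rw [image_iUnion]
    refine MeasurableSet.iUnion fun n => ?_
    exact (@IsCompact.image α β t' _ _ _ (hK n) hfc).measurableSet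

/-- In a standard Borel space the image of a measurable set under a non-singular map is measurable
for the completed measure. -/
theorem Nonsingular.nullMeasurableSet_image {X : Type*} [MeasurableSpace X]
    [StandardBorelSpace X] {μ : Measure X} [SFinite μ] {f : X → X} (hf : Nonsingular μ f)
    {S : Set X} (hS : MeasurableSet S) : NullMeasurableSet (f '' S) μ := by
  let := upgradeStandardBorel X
  obtain ⟨K, hKS, hK0, hK⟩ := exists_measurableSet_image μ.toFinite hf.1 hS
  rw [← union_sdiff_cancel hKS, image_union]
  exact hK.nullMeasurableSet.union (NullMeasurableSet.of_null
    ((hf.image_null_iff _).2 (absolutelyContinuous_toFinite μ hK0)))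

/-- A microcosm: a set of non-singular transformations that contains the identity and is closed
under composition. -/
structure Microcosm {X : Type*} [MeasurableSpace X] (μ : Measure X) where
  maps : Set (X → X)
  nonsingular : ∀ f ∈ maps, Nonsingular μ f
  id_mem : (fun x => x) ∈ maps
  comp_mem : ∀ f ∈ maps, ∀ g ∈ maps, f ∘ g ∈ maps

/-- `f` is compilable in `N`: on each piece of some finite measurable partition, `f` agrees
almost everywhere with an element of `N`. -/
def CompilableIn {X : Type*} [MeasurableSpace X] (μ : Measure X) (f : X → X)
    (N : Set (X → X)) : Prop :=
  ∃ (k : ℕ) (P : Fin k → Set X) (g : Fin k → X → X),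
    (∀ i, MeasurableSet (P i)) ∧ Pairwise (fun i j => Disjoint (P i) (P j)) ∧
    (⋃ i, P i) = univ ∧ ∀ i, g i ∈ N ∧ f =ᵐ[μ.restrict (P i)] g i

/-- The compilation preorder on microcosms. -/
def Microcosm.Compilable {X : Type*} [MeasurableSpace X] {μ : Measure X}
    (m n : Microcosm μ) : Prop :=
  ∀ f ∈ m.maps, CompilableIn μ f n.maps

/-- Compilation equivalence of microcosms. -/
def Microcosm.CompEquiv {X : Type*} [MeasurableSpace X] {μ : Measure X}
    (m n : Microcosm μ) : Prop :=
  m.Compilable n ∧ n.Compilable m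

/-! ## The measure space -/

/-- The underlying space `ℤ × [0,1]^ℕ`. -/
abbrev Space : Type := ℤ × (ℕ → unitInterval)

/-- The product of the counting measure on `ℤ` and of the Lebesgue measure on the Hilbert cube. -/
def lam : Measure Space :=
  (Measure.count : Measure ℤ).prod (Measure.infinitePi fun _ : ℕ => (volume : Measure unitInterval))

instance sigmaFinite_lam : SigmaFinite lam := by unfold lam; infer_instance

/-! ## Graphings -/

/-- `Ω`-weighted (thick) graphings of carrier `V`. The finite set `Dialect` is the set of states:
the edge `e`, of weight `weight e`, goes from `source e × {src e}` to `real e '' source e × {tgt e}`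
and is realised by the restriction of `real e` to `source e`. Graphings without states
are those whose dialect has one element. -/
structure Graphing (Ω : Type u) (V : Set Space) where
  Dialect : Type
  dialect_finite : Finite Dialect
  dialect_nonempty : Nonempty Dialect
  Edge : Type
  edge_countable : Countable Edge
  weight : Edge → Ω
  source : Edge → Set Space
  real : Edge → Space → Space
  src : Edge → Dialect
  tgt : Edge → Dialect
  measurableSet_carrier : MeasurableSet V
  nonsingular_real : ∀ e, Nonsingular lam (real e)
  measurableSet_source : ∀ e, MeasurableSet (source e)
  nullMeasurableSet_target : ∀ e, NullMeasurableSet (real e '' source e) lam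
  source_subset : ∀ e, source e ⊆ V
  target_subset : ∀ e, real e '' source e ⊆ V

/-- The graphing `F` is a graphing in the microcosm `m`: each edge is the restriction to its source
of an element of `m`. -/
def Graphing.IsIn {Ω : Type u} {V : Set Space} (F : Graphing Ω V) (m : Microcosm lam) : Prop :=
  ∀ e, ∃ g ∈ m.maps, EqOn (F.real e) g (F.source e)

/-- The kinds of graphings. For probabilistic graphings the multiplicative monoid `[0,1]` is
a submonoid of the monoid of weights, through `ι`. -/
inductive Kind (Ω : Type u) [Monoid Ω] : Type u
  | general : Kind Ω
  | deterministic : Kind Ω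
  | nondeterministic : Kind Ω
  | probabilistic (ι : unitInterval →* Ω) (hι : Function.Injective ι) : Kind Ω

/-- `ω ∈ {0, 1}`, where `0` is the absorbing element of `Ω`, if there is one. -/
def IsZeroOrOne {Ω : Type u} [Monoid Ω] (ω : Ω) : Prop :=
  ω = 1 ∨ ∀ a : Ω, a * ω = ω ∧ ω * a = ω

open Classical in
/-- The graphing `F` is of the given kind. -/
def Graphing.IsOfKind {Ω : Type u} [Monoid Ω] {V : Set Space} (F : Graphing Ω V) :
    Kind Ω → Prop
  | .general => True
  | .deterministic => (∀ e, IsZeroOrOne (F.weight e)) ∧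
      ∀ d, lam {x | ∃ e e', e ≠ e' ∧ F.src e = d ∧ F.src e' = d ∧
        x ∈ F.source e ∩ F.source e'} = 0
  | .nondeterministic => ∀ e, IsZeroOrOne (F.weight e)
  | .probabilistic ι _ => ∃ p : F.Edge → unitInterval, (∀ e, F.weight e = ι (p e)) ∧
      ∀ d, lam {x | 1 < ∑' e, if F.src e = d ∧ x ∈ F.source e
        then ENNReal.ofReal (p e : ℝ) else 0} = 0

/-! ## Alternating paths and cycles, execution, measurement -/

section Plugging

variable {Ω : Type u} {V W : Set Space} (F : Graphing Ω V) (G : Graphing Ω W)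

/-- The edges of `F` and `G`, both made to act on the product of the dialects: an edge of `F`
leaves the state of `G` unchanged and conversely. -/
abbrev JointEdge : Type := (F.Edge × G.Dialect) ⊕ (G.Edge × F.Dialect)

variable {F G}

def JointEdge.weight : JointEdge F G → Ω
  | .inl (e, _) => F.weight e
  | .inr (e, _) => G.weight e

def JointEdge.source : JointEdge F G → Set Space
  | .inl (e, _) => F.source e
  | .inr (e, _) => G.source e

def JointEdge.real : JointEdge F G → Space → Space
  | .inl (e, _) => F.real e
  | .inr (e, _) => G.real e

def JointEdge.src : JointEdge F G → F.Dialect × G.Dialect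
  | .inl (e, d) => (F.src e, d)
  | .inr (e, d) => (d, G.src e)

def JointEdge.tgt : JointEdge F G → F.Dialect × G.Dialect
  | .inl (e, d) => (F.tgt e, d)
  | .inr (e, d) => (d, G.tgt e)

/-- `b` may follow `a` in an alternating path: they do not belong to the same graphing, and `b`
starts in the state where `a` ends. -/
def JointEdge.Follows (a b : JointEdge F G) : Prop :=
  a.isLeft ≠ b.isLeft ∧ a.tgt = b.src

/-- Alternating paths between `F` and `G`. -/
def IsAltPath (l : List (JointEdge F G)) : Prop :=
  l ≠ [] ∧ l.IsChain JointEdge.Follows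

/-- Alternating cycles (with a base point) between `F` and `G`. -/
def IsAltCycle (l : List (JointEdge F G)) : Prop :=
  IsAltPath l ∧ ∀ a ∈ l.getLast?, ∀ b ∈ l.head?, a.Follows b

/-- The composite of the realisations of the edges of a path, in the order of the path. -/
def pathMap : List (JointEdge F G) → Space → Space
  | [] => fun x => x
  | e :: l => pathMap l ∘ JointEdge.real e

/-- The points at which each step of the path is defined. -/
def pathDomain : List (JointEdge F G) → Set Space
  | [] => univ
  | e :: l => JointEdge.source e ∩ JointEdge.real e ⁻¹' pathDomain l

def pathWeight [Monoid Ω] (l : List (JointEdge F G)) : Ω :=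
  (l.map JointEdge.weight).prod

/-- The points `x` whose orbit along `l` closes up at the end of `l`, and is
not the repetition of a shorter closed orbit along a cycle of which `l` is a power. -/
def cycleSet (l : List (JointEdge F G)) : Set Space :=
  {x | x ∈ pathDomain l ∧ pathMap l x = x ∧
    ∀ d, 0 < d → d < l.length → l.rotate d = l → pathMap (l.take d) x ≠ x}

variable (F G)

open Classical in
/-- The measurement `⟦F, G⟧` given by `wt : Ω → [0, ∞]`: the integral, over the closed orbits along
alternating cycles between `F` and `G`, of `wt` of the weight of the orbit. An
orbit of length `k` is counted once for each of its `k` base points, with factor `1 / k`; dialects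
carry the normalised counting measure. For measure-preserving edges and `wt (a * b) = wt (b * a)`
this is the sum over all non-repeating alternating cycles `π`, up to rotation, of
`∫ wt (ω(π) ^ ρ x) / ρ x dx` over the points `x` of finite period `ρ x` under the partial map
`φ_π`. -/
def Graphing.meas [Monoid Ω] (wt : Ω → ℝ≥0∞) : ℝ≥0∞ :=
  (∑' l : List (JointEdge F G),
    if IsAltCycle l then wt (pathWeight l) / (l.length : ℝ≥0∞) * lam (cycleSet l) else 0) /
  ((Nat.card F.Dialect : ℝ≥0∞) * (Nat.card G.Dialect : ℝ≥0∞))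

variable {F G}

theorem nonsingular_pathMap (l : List (JointEdge F G)) : Nonsingular lam (pathMap l) := by
  induction l with
  | nil => exact Nonsingular.id lam
  | cons e l ih =>
    refine ih.comp ?_
    rcases e with ⟨e, _⟩ | ⟨e, _⟩
    · exact F.nonsingular_real e
    · exact G.nonsingular_real e

theorem measurableSet_pathDomain (l : List (JointEdge F G)) : MeasurableSet (pathDomain l) := by
  induction l with
  | nil => exact MeasurableSet.univ
  | cons e l ih =>
    rcases e with ⟨e, _⟩ | ⟨e, _⟩
    · exact (F.measurableSet_source e).inter ((F.nonsingular_real e).1 ih)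
    · exact (G.measurableSet_source e).inter ((G.nonsingular_real e).1 ih)

theorem pathDomain_subset {l : List (JointEdge F G)} (hl : l ≠ []) : pathDomain l ⊆ V ∪ W := by
  cases l with
  | nil => exact absurd rfl hl
  | cons e l =>
    rintro x ⟨hx, -⟩
    rcases e with ⟨e, _⟩ | ⟨e, _⟩
    · exact Or.inl (F.source_subset e hx)
    · exact Or.inr (G.source_subset e hx)

theorem pathMap_mem {l : List (JointEdge F G)} (hl : l ≠ []) {x : Space}
    (hx : x ∈ pathDomain l) : pathMap l x ∈ V ∪ W := by
  induction l generalizing x with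
  | nil => exact absurd rfl hl
  | cons e l ih =>
    by_cases h : l = []
    · subst h
      rcases e with ⟨e, _⟩ | ⟨e, _⟩
      · exact Or.inl (F.target_subset e ⟨x, hx.1, rfl⟩)
      · exact Or.inr (G.target_subset e ⟨x, hx.1, rfl⟩)
    · exact ih h hx.2

/-- The points where the path `l` is defined, starts outside of `V ∩ W` and ends outside of
`V ∩ W`. -/
def outerDomain (l : List (JointEdge F G)) : Set Space :=
  {x | x ∈ pathDomain l ∧ x ∉ V ∩ W ∧ pathMap l x ∉ V ∩ W}

theorem measurableSet_outerDomain (l : List (JointEdge F G)) : MeasurableSet (outerDomain l) :=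
  (measurableSet_pathDomain l).inter
    ((F.measurableSet_carrier.inter G.measurableSet_carrier).compl.inter
      ((nonsingular_pathMap l).1 (F.measurableSet_carrier.inter G.measurableSet_carrier).compl))

variable (F G)

/-- The execution `F :: G`: its edges are the alternating paths between `F` and `G`, restricted to
the points where they start and end outside of the common part `V ∩ W` of the carriers. -/
def Graphing.exec [Monoid Ω] : Graphing Ω (symmDiff V W) where
  Dialect := F.Dialect × G.Dialect
  dialect_finite := by
    have := F.dialect_finite
    have := G.dialect_finite
    infer_instance
  dialect_nonempty := by
    have := F.dialect_nonempty
    have := G.dialect_nonempty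
    infer_instance
  Edge := {l : List (JointEdge F G) // IsAltPath l}
  edge_countable := by
    have := F.dialect_finite
    have := G.dialect_finite
    have := F.edge_countable
    have := G.edge_countable
    infer_instance
  weight l := pathWeight l.1
  source l := outerDomain l.1
  real l := pathMap l.1
  src l := (l.1.head l.2.1).src
  tgt l := (l.1.getLast l.2.1).tgt
  measurableSet_carrier := F.measurableSet_carrier.symmDiff G.measurableSet_carrier
  nonsingular_real l := nonsingular_pathMap l.1
  measurableSet_source l := measurableSet_outerDomain l.1
  nullMeasurableSet_target l :=
    (nonsingular_pathMap l.1).nullMeasurableSet_image (measurableSet_outerDomain l.1)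
  source_subset l := by
    rintro x ⟨hx, hx', -⟩
    rw [symmDiff_eq_sup_sdiff_inf]
    exact ⟨pathDomain_subset l.2.1 hx, hx'⟩
  target_subset l := by
    rintro _ ⟨x, ⟨hx, -, hx'⟩, rfl⟩
    rw [symmDiff_eq_sup_sdiff_inf]
    exact ⟨pathMap_mem l.2.1 hx, hx'⟩

end Plugging

/-! ## Projects, orthogonality, types -/

/-- Projects: the elements of the model. A project consists of a wager in `ℝ ∪ {∞}` and of a finite
formal linear combination (the slices) of graphings of the same carrier. -/
structure Project (Ω : Type u) where
  carrier : Set Space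
  wager : WithTop ℝ
  Slice : Type
  slice_fintype : Fintype Slice
  coeff : Slice → ℝ
  graphing : Slice → Graphing Ω carrier

namespace Project

variable {Ω : Type u} [Monoid Ω]

/-- The sum `1_A` of the coefficients of the slices. -/
def unit (a : Project Ω) : ℝ :=
  letI := a.slice_fintype
  ∑ i, a.coeff i

/-- The inclusion of `[0, ∞]` in `ℝ ∪ {∞}`. -/
def ofENNReal (r : ℝ≥0∞) : WithTop ℝ :=
  WithTop.map (fun t : ℝ≥0 => (t : ℝ)) r

/-- The pairing `⟪a, b⟫ = a 1_B + b 1_A + ∑ α_i β_j ⟦A_i, B_j⟧` of two projects. -/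
def pairing (wt : Ω → ℝ≥0∞) (a b : Project Ω) : WithTop ℝ :=
  letI := a.slice_fintype
  letI := b.slice_fintype
  a.wager * (b.unit : WithTop ℝ) + b.wager * (a.unit : WithTop ℝ) +
    ∑ i, ∑ j, ((a.coeff i * b.coeff j : ℝ) : WithTop ℝ) *
      ofENNReal ((a.graphing i).meas (b.graphing j) wt)

/-- Orthogonality of two projects of the same carrier: the pairing is neither `0` nor `∞`. -/
def Orthogonal (wt : Ω → ℝ≥0∞) (a b : Project Ω) : Prop :=
  a.carrier = b.carrier ∧ pairing wt a b ≠ 0 ∧ pairing wt a b ≠ ⊤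

/-- The execution `a :: b` of two projects. -/
def exec (wt : Ω → ℝ≥0∞) (a b : Project Ω) : Project Ω where
  carrier := symmDiff a.carrier b.carrier
  wager := pairing wt a b
  Slice := a.Slice × b.Slice
  slice_fintype :=
    letI := a.slice_fintype
    letI := b.slice_fintype
    inferInstance
  coeff i := a.coeff i.1 * b.coeff i.2
  graphing i := (a.graphing i.1).exec (b.graphing i.2)

/-- Each slice of the project is a graphing of kind `κ`. -/
def IsOfKind (κ : Kind Ω) (a : Project Ω) : Prop :=
  ∀ i, (a.graphing i).IsOfKind κ

/-- Each slice of the project is a graphing in the microcosm `m`. -/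
def IsIn (m : Microcosm lam) (a : Project Ω) : Prop :=
  ∀ i, (a.graphing i).IsIn m

end Project

variable {Ω : Type u} [Monoid Ω]

/-- The orthogonal of a set `A` of projects, among the projects of kind `κ` and carrier `V`. -/
def orth (wt : Ω → ℝ≥0∞) (κ : Kind Ω) (V : Set Space) (A : Set (Project Ω)) : Set (Project Ω) :=
  {b | b.carrier = V ∧ b.IsOfKind κ ∧ ∀ a ∈ A, a.Orthogonal wt b}

/-- Types (conducts) of carrier `V`: the sets of projects equal to their bi-orthogonal. -/
def IsConduct (wt : Ω → ℝ≥0∞) (κ : Kind Ω) (V : Set Space) (A : Set (Project Ω)) : Prop :=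
  MeasurableSet V ∧ orth wt κ V (orth wt κ V A) = A

/-- The type `A ⊸ B`, for types `A`, `B` of disjoint carriers `V`, `W`. -/
def lolli (wt : Ω → ℝ≥0∞) (κ : Kind Ω) (V W : Set Space) (A B : Set (Project Ω)) :
    Set (Project Ω) :=
  {f | f.carrier = V ∪ W ∧ f.IsOfKind κ ∧ ∀ a ∈ A, f.exec wt a ∈ B}

/-! ## Words -/

/-- The `i`-th of the `N` pieces, of length `1 / N`, of the unit interval. -/
def piece (N i : ℕ) : Set unitInterval :=
  {t | (i : ℝ) / N ≤ (t : ℝ) ∧ (t : ℝ) < ((i : ℝ) + 1) / N}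

open Classical in
/-- The exchange of the `i`-th and `j`-th of the `N` pieces of the unit interval; on the `i`-th piece
it is the translation by `(j - i) / N`. -/
def swapPiece (N i j : ℕ) (t : unitInterval) : unitInterval :=
  if t ∈ piece N i then projIcc (0 : ℝ) 1 zero_le_one (t + ((j : ℝ) - i) / N)
  else if t ∈ piece N j then projIcc (0 : ℝ) 1 zero_le_one (t + ((i : ℝ) - j) / N)
  else t

/-- The map `(n, x) ↦ (n + k, x')` where `x'` is `x` with its first coordinate changed by the
exchange of the `i`-th and `j`-th of `N` pieces. -/
def wordMap (k : ℤ) (N i j : ℕ) (x : Space) : Space :=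
  (x.1 + k, fun r => if r = 0 then swapPiece N i j (x.2 r) else x.2 r)

theorem measurableSet_piece (N i : ℕ) : MeasurableSet (piece N i) :=
  (measurableSet_le measurable_const measurable_subtype_coe).inter
    (measurableSet_lt measurable_subtype_coe measurable_const)

theorem disjoint_piece {N i j : ℕ} (hij : i ≠ j) : Disjoint (piece N i) (piece N j) := by
  rw [Set.disjoint_left]
  rintro t ⟨h1, h2⟩ ⟨h3, h4⟩
  have hN : (0 : ℝ) ≤ N := Nat.cast_nonneg N
  rcases lt_or_gt_of_ne hij with h | h
  · have h' : (i : ℝ) + 1 ≤ j := by exact_mod_cast h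
    have := div_le_div_of_nonneg_right h' hN
    linarith
  · have h' : (j : ℝ) + 1 ≤ i := by exact_mod_cast h
    have := div_le_div_of_nonneg_right h' hN
    linarith

theorem shift_mem {N i j : ℕ} (hj : j < N) {t : unitInterval} (ht : t ∈ piece N i) :
    projIcc (0 : ℝ) 1 zero_le_one (t + ((j : ℝ) - i) / N) ∈ piece N j ∧
    ((projIcc (0 : ℝ) 1 zero_le_one (t + ((j : ℝ) - i) / N) : unitInterval) : ℝ) =
      t + ((j : ℝ) - i) / N := by
  have hN : (0 : ℝ) < N := by exact_mod_cast (Nat.zero_le j).trans_lt hj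
  have hj' : (j : ℝ) + 1 ≤ N := by exact_mod_cast hj
  obtain ⟨h1, h2⟩ := ht
  have e1 : ((j : ℝ) - i) / N = j / N - i / N := sub_div _ _ _
  have e2 : ((i : ℝ) + 1) / N = i / N + 1 / N := add_div _ _ _
  have e3 : ((j : ℝ) + 1) / N = j / N + 1 / N := add_div _ _ _
  have h5 : ((j : ℝ) + 1) / N ≤ 1 := (div_le_one hN).2 hj'
  have h6 : (0 : ℝ) ≤ j / N := by positivity
  have h : ((projIcc (0 : ℝ) 1 zero_le_one (t + ((j : ℝ) - i) / N) : unitInterval) : ℝ) =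
      t + ((j : ℝ) - i) / N := by
    rw [projIcc_of_mem zero_le_one ⟨by linarith, by linarith⟩]
  refine ⟨⟨?_, ?_⟩, h⟩ <;> rw [h] <;> linarith

theorem swapPiece_comm (N i j : ℕ) : swapPiece N i j = swapPiece N j i := by
  funext t
  by_cases hij : i = j
  · rw [hij]
  · unfold swapPiece
    by_cases h1 : t ∈ piece N i
    · have h2 : t ∉ piece N j := Set.disjoint_left.1 (disjoint_piece hij) h1
      simp [h1, h2]
    · simp [h1]

theorem swapPiece_of_mem {N i j : ℕ} (hj : j < N) {t : unitInterval} (ht : t ∈ piece N i) :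
    swapPiece N i j t ∈ piece N j ∧ (swapPiece N i j t : ℝ) = t + ((j : ℝ) - i) / N := by
  unfold swapPiece
  rw [if_pos ht]
  exact shift_mem hj ht

theorem swapPiece_of_notMem {N i j : ℕ} {t : unitInterval} (hi : t ∉ piece N i)
    (hj : t ∉ piece N j) : swapPiece N i j t = t := by
  simp [swapPiece, hi, hj]

theorem swapPiece_swapPiece {N i j : ℕ} (hi : i < N) (hj : j < N) (t : unitInterval) :
    swapPiece N i j (swapPiece N i j t) = t := by
  have key : ∀ {i j : ℕ}, i < N → j < N → t ∈ piece N i →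
      swapPiece N i j (swapPiece N i j t) = t := by
    intro i j hi hj ht
    obtain ⟨h1, h2⟩ := swapPiece_of_mem hj ht
    rw [swapPiece_comm N i j] at h1 h2 ⊢
    have h3 := (swapPiece_of_mem hi h1).2
    apply Subtype.ext
    rw [h3, h2]
    ring
  by_cases h1 : t ∈ piece N i
  · exact key hi hj h1
  · by_cases h2 : t ∈ piece N j
    · rw [swapPiece_comm N i j]
      exact key hj hi h2
    · rw [swapPiece_of_notMem h1 h2, swapPiece_of_notMem h1 h2]

theorem measurable_swapPiece (N i j : ℕ) : Measurable (swapPiece N i j) := by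
  have h : ∀ c : ℝ, Measurable fun t : unitInterval =>
      projIcc (0 : ℝ) 1 zero_le_one ((t : ℝ) + c) := fun c =>
    continuous_projIcc.measurable.comp (measurable_subtype_coe.add_const c)
  exact Measurable.ite (measurableSet_piece N i) (h _)
    (Measurable.ite (measurableSet_piece N j) (h _) measurable_id)

theorem volume_swapPiece_inter {N i j : ℕ} (hi : i < N) (hj : j < N) (A : Set unitInterval) :
    volume (swapPiece N i j ⁻¹' A ∩ piece N i) = volume (A ∩ piece N j) := by
  rw [unitInterval.volume_apply, unitInterval.volume_apply,
    ← measure_preimage_add_right volume (((j : ℝ) - i) / N) (Subtype.val '' (A ∩ piece N j))]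
  congr 1
  ext r
  constructor
  · rintro ⟨t, ⟨htA, ht⟩, rfl⟩
    obtain ⟨h1, h2⟩ := swapPiece_of_mem hj ht
    exact ⟨_, ⟨htA, h1⟩, h2⟩
  · rintro ⟨t, ⟨htA, ht⟩, h⟩
    obtain ⟨h1, h2⟩ := swapPiece_of_mem hi ht
    rw [swapPiece_comm] at h1 h2
    refine ⟨_, ⟨?_, h1⟩, ?_⟩
    · rw [mem_preimage, swapPiece_swapPiece hi hj]
      exact htA
    · rw [h2, h]
      ring

theorem measurePreserving_swapPiece {N i j : ℕ} (hi : i < N) (hj : j < N) :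
    MeasurePreserving (swapPiece N i j) := by
  refine ⟨measurable_swapPiece N i j, Measure.ext fun A hA => ?_⟩
  rw [Measure.map_apply (measurable_swapPiece N i j) hA]
  by_cases hij : i = j
  · subst hij
    have : swapPiece N i i = fun t => t := by
      funext t
      by_cases h : t ∈ piece N i
      · apply Subtype.ext
        rw [(swapPiece_of_mem hi h).2]
        simp
      · exact swapPiece_of_notMem h h
    rw [this]
    rfl
  · have split : ∀ B : Set unitInterval, volume B =
        volume (B ∩ piece N i) + (volume (B ∩ piece N j) + volume ((B \ piece N i) \ piece N j)) := by
      intro B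
      rw [← measure_inter_add_sdiff B (measurableSet_piece N i),
        ← measure_inter_add_sdiff (B \ piece N i) (measurableSet_piece N j)]
      congr 3
      ext t
      constructor
      · rintro ⟨⟨h1, -⟩, h3⟩
        exact ⟨h1, h3⟩
      · rintro ⟨h1, h3⟩
        exact ⟨⟨h1, fun h => Set.disjoint_left.1 (disjoint_piece hij) h h3⟩, h3⟩
    rw [split, split A, volume_swapPiece_inter hi hj]
    have h2 : volume (swapPiece N i j ⁻¹' A ∩ piece N j) = volume (A ∩ piece N i) := by
      rw [swapPiece_comm]
      exact volume_swapPiece_inter hj hi A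
    rw [h2, add_left_comm]
    congr 3
    ext t
    constructor
    · rintro ⟨⟨h1, h2⟩, h3⟩
      rw [mem_preimage, swapPiece_of_notMem h2 h3] at h1
      exact ⟨⟨h1, h2⟩, h3⟩
    · rintro ⟨⟨h1, h2⟩, h3⟩
      refine ⟨⟨?_, h2⟩, h3⟩
      rw [mem_preimage, swapPiece_of_notMem h2 h3]
      exact h1

theorem measurePreserving_wordMap (k : ℤ) {N i j : ℕ} (hi : i < N) (hj : j < N) :
    MeasurePreserving (wordMap k N i j) lam lam := by
  have h1 : MeasurePreserving (fun n : ℤ => n + k) Measure.count Measure.count :=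
    measurePreserving_add_right _ k
  have h2 : MeasurePreserving
      (fun (x : ℕ → unitInterval) r => (if r = 0 then swapPiece N i j else fun t => t) (x r))
      (Measure.infinitePi fun _ => volume) (Measure.infinitePi fun _ => volume) := by
    have hm : ∀ r : ℕ, MeasurePreserving
        (if r = 0 then swapPiece N i j else fun t : unitInterval => t) volume volume := by
      intro r
      by_cases hr : r = 0
      · rw [if_pos hr]
        exact measurePreserving_swapPiece hi hj
      · rw [if_neg hr]
        exact MeasurePreserving.id volume
    refine ⟨measurable_pi_lambda _ fun r => (hm r).measurable.comp (measurable_pi_apply r), ?_⟩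
    rw [Measure.infinitePi_map_pi _ fun r => (hm r).measurable]
    congr 1
    funext r
    exact (hm r).map_eq
  have h3 := h1.prod h2
  suffices h4 : wordMap k N i j = Prod.map (fun n : ℤ => n + k)
      (fun (x : ℕ → unitInterval) r =>
        (if r = 0 then swapPiece N i j else fun t => t) (x r)) by
    rw [h4]
    exact h3
  funext x
  refine Prod.ext rfl (funext fun r => ?_)
  by_cases hr : r = 0 <;> simp [wordMap, hr]

theorem wordMap_wordMap (k : ℤ) {N i j : ℕ} (hi : i < N) (hj : j < N) (x : Space) :
    wordMap k N i j (wordMap (-k) N i j x) = x := by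
  refine Prod.ext (by simp [wordMap]) (funext fun r => ?_)
  by_cases hr : r = 0 <;> simp [wordMap, hr, swapPiece_swapPiece hi hj]

theorem nonsingular_wordMap (k : ℤ) {N i j : ℕ} (hi : i < N) (hj : j < N) :
    Nonsingular lam (wordMap k N i j) := by
  refine ⟨(measurePreserving_wordMap k hi hj).measurable, fun A hA => ?_⟩
  have : wordMap k N i j '' A = wordMap (-k) N i j ⁻¹' A := by
    ext x
    constructor
    · rintro ⟨y, hy, rfl⟩
      have := wordMap_wordMap (-k) hi hj y
      rw [neg_neg] at this
      rwa [mem_preimage, this]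
    · intro hx
      exact ⟨_, hx, wordMap_wordMap k hi hj x⟩
  rw [this, (measurePreserving_wordMap (-k) hi hj).measure_preimage hA.nullMeasurableSet]

/-- The two ports of a symbol. -/
inductive Port
  | In
  | Out

section Words

variable {α : Type*} (loc : Option α × Port ↪ ℤ)

/-- The `i`-th symbol of the list `⋆ w`, where `⋆` is `none`. -/
def symbolAt (w : List α) (i : Fin (w.length + 1)) : Option α :=
  Fin.cases (motive := fun _ => Option α) none (fun j => some (w.get j)) i

/-- The carrier of the representations of words: the vertex `v` is realised as `{loc v} × [0,1]^ℕ`. -/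
def wordCarrier : Set Space :=
  {x | x.1 ∈ range loc}

/-- The vertex `v`, restricted to the `i`-th of `N` pieces of the first unit interval. -/
def wordPiece (v : Option α × Port) (N i : ℕ) : Set Space :=
  {x | x.1 = loc v ∧ x.2 0 ∈ piece N i}

theorem measurableSet_wordPiece (v : Option α × Port) (N i : ℕ) :
    MeasurableSet (wordPiece loc v N i) :=
  (measurable_fst (measurableSet_singleton (loc v))).inter
    ((measurable_pi_apply (0 : ℕ)).comp (measurable_snd (α := ℤ) (β := ℕ → unitInterval))
      (measurableSet_piece N i))

/-- The graphing representing the word `w`. With `N` the length of `⋆ w`, for each `i` modulo `N`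
there are an edge `(i, true)`, from the `i`-th piece of the output of the `i`-th symbol to the
`(i+1)`-th piece of the input of the `(i+1)`-th symbol, and an edge `(i, false)` in
the reverse direction, both realised by translations. -/
def wordGraphing (Ω : Type u) [Monoid Ω] (w : List α) : Graphing Ω (wordCarrier loc) where
  Dialect := Unit
  dialect_finite := inferInstance
  dialect_nonempty := inferInstance
  Edge := Fin (w.length + 1) × Bool
  edge_countable := inferInstance
  weight _ := 1
  source
    | (i, true) => wordPiece loc (symbolAt w i, .Out) (w.length + 1) i
    | (i, false) => wordPiece loc (symbolAt w (i + 1), .In) (w.length + 1) ((i + 1 : Fin _) : ℕ)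
  real
    | (i, true) => wordMap (loc (symbolAt w (i + 1), .In) - loc (symbolAt w i, .Out))
        (w.length + 1) i ((i + 1 : Fin _) : ℕ)
    | (i, false) => wordMap (loc (symbolAt w i, .Out) - loc (symbolAt w (i + 1), .In))
        (w.length + 1) ((i + 1 : Fin _) : ℕ) i
  src _ := ()
  tgt _ := ()
  measurableSet_carrier := measurable_fst (MeasurableSpace.measurableSet_top (s := range loc))
  nonsingular_real := by
    rintro ⟨i, _ | _⟩
    · exact nonsingular_wordMap _ (i + 1).2 i.2
    · exact nonsingular_wordMap _ i.2 (i + 1).2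
  measurableSet_source := by
    rintro ⟨i, _ | _⟩ <;> exact measurableSet_wordPiece loc _ _ _
  nullMeasurableSet_target := by
    rintro ⟨i, _ | _⟩
    · exact (nonsingular_wordMap _ (i + 1).2 i.2).nullMeasurableSet_image
        (measurableSet_wordPiece loc _ _ _)
    · exact (nonsingular_wordMap _ i.2 (i + 1).2).nullMeasurableSet_image
        (measurableSet_wordPiece loc _ _ _)
  source_subset := by
    rintro ⟨i, _ | _⟩ x ⟨hx, -⟩ <;> exact ⟨_, hx.symm⟩
  target_subset := by
    rintro ⟨i, _ | _⟩ _ ⟨x, ⟨hx, -⟩, rfl⟩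
    · exact ⟨(symbolAt w i, .Out), by simp [wordMap, hx]⟩
    · exact ⟨(symbolAt w (i + 1), .In), by simp [wordMap, hx]⟩

/-- The element `!L_w` that represents the word `w`: wager `0` and a single slice. -/
def wordProject (Ω : Type u) [Monoid Ω] (w : List α) : Project Ω where
  carrier := wordCarrier loc
  wager := 0
  Slice := Unit
  slice_fintype := inferInstance
  coeff _ := 1
  graphing _ := wordGraphing loc Ω w

/-- The type `!List` of words: the bi-orthogonal closure of the representations of words. -/
def wordType (wt : Ω → ℝ≥0∞) (κ : Kind Ω) : Set (Project Ω) :=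
  orth wt κ (wordCarrier loc) (orth wt κ (wordCarrier loc) (range (wordProject loc Ω)))

/-- The language `[P]_T`: the words `w` such that `P :: !L_w` is orthogonal to the test `T`,
a family of projects. -/
def language (wt : Ω → ℝ≥0∞) (T : Set (Project Ω)) (P : Project Ω) : Set (List α) :=
  {w | ∀ t ∈ T, (P.exec wt (wordProject loc Ω w)).Orthogonal wt t}

/-- The class `C[m]` of the languages `[P]_T`, for the elements `P` of `!List ⊸ B` in the
microcosm `m`. Here `B`, of carrier `W`, is the type of truth values. -/
def complexityClass (wt : Ω → ℝ≥0∞) (κ : Kind Ω) (W : Set Space) (B T : Set (Project Ω))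
    (m : Microcosm lam) : Set (Set (List α)) :=
  {L | ∃ P ∈ lolli wt κ (wordCarrier loc) W (wordType loc wt κ) B,
    P.IsIn m ∧ language loc wt T P = L}

end Words

end

end Microcosmos

namespace Microcosmos

noncomputable section

/-! ## Refinements of graphings -/

/-! Take a graphing in `m`. On the source of each edge, the realisation is an element of `m`, hence
almost everywhere one of finitely many elements of `n` on the pieces of a partition. Cutting the
edge along these pieces, and discarding the null sets where the maps disagree, gives a graphing in
`n` that moves almost every point in the same way, with the same weights and states. It remains to
see that nothing in the definition of the class detects such a cut.

The key is that paths lift almost uniquely. Over a path `l` of the coarse graphings, the domains of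
the paths of the refined graphings that project to `l` are pairwise disjoint
(`eq_of_mem_pathDomain`) and cover the domain of `l` up to a null set (`pathDomain_cover`). The
second fact rests on non-singularity: the preimage of a null set is null, so the points lost at a
late step of a path come from a null set of starting points. Hence the execution of refinements is a
refinement of the execution. For cycles, exclusion of repeated orbits must also be compatible with
lifting: if the orbit of a point closes up early along a cycle that is a power, uniqueness of lifts
forces the lifted cycle to be a power too (`cycleSet_eq`). Summing over lifts then gives equality of
the measurements (`Refinement.meas_eq`).

So pairings, orthogonality, kinds and languages are invariant under refinement, every orthogonal and
thus every type is closed under it, and a witness in `m` can be replaced by its refinement in `n`.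
-/

/-- A refinement of the graphing `F`: every edge of `F` is cut, up to a null set, into edges of `F'`
with pairwise disjoint sources, the same realisation, the same weight and the same states. -/
structure Refinement {Ω : Type u} {V : Set Space} (F' F : Graphing Ω V) where
  edge : F'.Edge → F.Edge
  dialect : F'.Dialect ≃ F.Dialect
  weight_eq : ∀ e, F'.weight e = F.weight (edge e)
  src_eq : ∀ e, dialect (F'.src e) = F.src (edge e)
  tgt_eq : ∀ e, dialect (F'.tgt e) = F.tgt (edge e)
  source_subset : ∀ e, F'.source e ⊆ F.source (edge e)
  real_eqOn : ∀ e, EqOn (F'.real e) (F.real (edge e)) (F'.source e)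
  eq_of_mem : ∀ e₁ e₂, edge e₁ = edge e₂ → ∀ x ∈ F'.source e₁, x ∈ F'.source e₂ → e₁ = e₂
  cover : ∀ e, lam {x | x ∈ F.source e ∧ ∀ e', edge e' = e → x ∉ F'.source e'} = 0

namespace Refinement

variable {Ω : Type u} {V W : Set Space}

/-- Each graphing refines itself. -/
def refl (F : Graphing Ω V) : Refinement F F where
  edge e := e
  dialect := Equiv.refl _
  weight_eq _ := rfl
  src_eq _ := rfl
  tgt_eq _ := rfl
  source_subset _ := Subset.rfl
  real_eqOn _ := fun _ _ => rfl
  eq_of_mem _ _ h _ _ _ := h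
  cover e := by
    refine measure_mono_null (fun x hx => ?_) (measure_empty (μ := lam))
    exact hx.2 e rfl hx.1

/-- Over each edge of `F`, at most one edge of `F'` is active at a given point. So two distinct
edges of `F'` that overlap in one state project to two distinct edges of `F`, and cutting does not
increase the total weight leaving a point. -/
theorem isOfKind [Monoid Ω] {F' F : Graphing Ω V} (r : Refinement F' F) {κ : Kind Ω}
    (h : F.IsOfKind κ) : F'.IsOfKind κ := by
  cases κ with
  | general => trivial
  | nondeterministic =>
    intro e
    rw [r.weight_eq]
    exact h _
  | deterministic =>
    refine ⟨fun e => by rw [r.weight_eq]; exact h.1 _, fun d => ?_⟩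
    refine measure_mono_null ?_ (h.2 (r.dialect d))
    rintro x ⟨e, e', hne, rfl, he', hx, hx'⟩
    refine ⟨r.edge e, r.edge e', fun heq => hne (r.eq_of_mem e e' heq x hx hx'),
      (r.src_eq e).symm, ?_, r.source_subset e hx, r.source_subset e' hx'⟩
    rw [← he', r.src_eq]
  | probabilistic ι hι =>
    obtain ⟨p, hp, hsum⟩ := h
    refine ⟨fun e => p (r.edge e), fun e => by rw [r.weight_eq, hp], fun d => ?_⟩
    refine measure_mono_null ?_ (hsum (r.dialect d))
    intro x hx
    rw [mem_ofPred_eq] at hx ⊢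
    refine hx.trans_le ?_
    -- Group the edges of `F'` by the edge of `F` they come from: each fibre contributes at most one
    -- nonzero term, bounded by the term of that edge of `F`.
    rw [← (Equiv.sigmaFiberEquiv r.edge).tsum_eq, ENNReal.tsum_sigma']
    refine ENNReal.tsum_le_tsum fun e => ?_
    by_cases hex : ∃ e' : {e' // r.edge e' = e}, F'.src e'.1 = d ∧ x ∈ F'.source e'.1
    · obtain ⟨e', hd, hx'⟩ := hex
      rw [tsum_eq_single e']
      · obtain ⟨e', rfl⟩ := e'
        have h1 : F.src (r.edge e') = r.dialect d := by rw [← r.src_eq, hd]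
        simp [Equiv.sigmaFiberEquiv, hd, hx', h1, r.source_subset e' hx']
      · rintro ⟨e'', he''⟩ hne
        refine if_neg fun hh => hne (Subtype.ext ?_)
        exact r.eq_of_mem _ _ (he''.trans e'.2.symm) x hh.2 hx'
    · refine le_of_eq_of_le (ENNReal.tsum_eq_zero.2 fun e' => if_neg fun hh => hex ⟨e', hh⟩) ?_
      exact zero_le

/-! ### Projection of joint edges and lifting of alternating paths -/

variable {F' F : Graphing Ω V} {G' G : Graphing Ω W} (r : Refinement F' F) (s : Refinement G' G)

/-- The action of two refinements on joint edges. -/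
def joint : JointEdge F' G' → JointEdge F G
  | .inl (e, d) => .inl (r.edge e, s.dialect d)
  | .inr (e, d) => .inr (s.edge e, r.dialect d)

theorem isLeft_joint (a : JointEdge F' G') : (r.joint s a).isLeft = a.isLeft := by
  rcases a with ⟨e, d⟩ | ⟨e, d⟩ <;> rfl

theorem weight_joint (a : JointEdge F' G') : (r.joint s a).weight = a.weight := by
  rcases a with ⟨e, d⟩ | ⟨e, d⟩
  · exact (r.weight_eq e).symm
  · exact (s.weight_eq e).symm

theorem src_joint (a : JointEdge F' G') :
    (r.joint s a).src = (r.dialect.prodCongr s.dialect) a.src := by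
  rcases a with ⟨e, d⟩ | ⟨e, d⟩
  · exact Prod.ext (r.src_eq e).symm rfl
  · exact Prod.ext rfl (s.src_eq e).symm

theorem tgt_joint (a : JointEdge F' G') :
    (r.joint s a).tgt = (r.dialect.prodCongr s.dialect) a.tgt := by
  rcases a with ⟨e, d⟩ | ⟨e, d⟩
  · exact Prod.ext (r.tgt_eq e).symm rfl
  · exact Prod.ext rfl (s.tgt_eq e).symm

theorem source_joint (a : JointEdge F' G') : a.source ⊆ (r.joint s a).source := by
  rcases a with ⟨e, d⟩ | ⟨e, d⟩
  · exact r.source_subset e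
  · exact s.source_subset e

theorem real_joint (a : JointEdge F' G') : EqOn a.real (r.joint s a).real a.source := by
  rcases a with ⟨e, d⟩ | ⟨e, d⟩
  · exact r.real_eqOn e
  · exact s.real_eqOn e

theorem joint_eq_of_mem {a b : JointEdge F' G'} (h : r.joint s a = r.joint s b) {x : Space}
    (ha : x ∈ a.source) (hb : x ∈ b.source) : a = b := by
  rcases a with ⟨e, d⟩ | ⟨e, d⟩ <;> rcases b with ⟨e', d'⟩ | ⟨e', d'⟩
  · have h1 := Prod.ext_iff.1 (Sum.inl.inj h)
    rw [r.eq_of_mem e e' h1.1 x ha hb, s.dialect.injective h1.2]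
  · cases h
  · cases h
  · have h1 := Prod.ext_iff.1 (Sum.inr.inj h)
    rw [s.eq_of_mem e e' h1.1 x ha hb, r.dialect.injective h1.2]

theorem joint_cover (a : JointEdge F G) :
    lam {x | x ∈ a.source ∧ ∀ a', r.joint s a' = a → x ∉ a'.source} = 0 := by
  rcases a with ⟨e, d⟩ | ⟨e, d⟩
  · refine measure_mono_null ?_ (r.cover e)
    refine fun x hx => ⟨hx.1, fun e' he' => ?_⟩
    exact hx.2 (.inl (e', s.dialect.symm d)) (by simp [joint, he'])
  · refine measure_mono_null ?_ (s.cover e)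
    refine fun x hx => ⟨hx.1, fun e' he' => ?_⟩
    exact hx.2 (.inr (e', r.dialect.symm d)) (by simp [joint, he'])

/-- An equivalence holds, not only an implication, because the dialects are in bijection: states
that match after projection matched before. -/
theorem follows_joint (a b : JointEdge F' G') :
    (r.joint s a).Follows (r.joint s b) ↔ a.Follows b := by
  unfold JointEdge.Follows
  rw [isLeft_joint, isLeft_joint, tgt_joint, src_joint, EmbeddingLike.apply_eq_iff_eq]

theorem isAltPath_map (l : List (JointEdge F' G')) :
    IsAltPath (l.map (r.joint s)) ↔ IsAltPath l := by
  unfold IsAltPath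
  rw [List.isChain_map]
  simp only [follows_joint, ne_eq, List.map_eq_nil_iff]

theorem isAltCycle_map (l : List (JointEdge F' G')) :
    IsAltCycle (l.map (r.joint s)) ↔ IsAltCycle l := by
  unfold IsAltCycle
  rw [isAltPath_map, List.getLast?_map, List.head?_map]
  simp only [Option.mem_map, forall_exists_index, and_imp, forall_apply_eq_imp_iff₂,
    follows_joint]

theorem pathWeight_map [Monoid Ω] (l : List (JointEdge F' G')) :
    pathWeight (l.map (r.joint s)) = pathWeight l := by
  unfold pathWeight
  rw [List.map_map]
  congr 2
  funext a
  exact weight_joint r s a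

theorem pathDomain_map_and_pathMap_map (l : List (JointEdge F' G')) {x : Space}
    (hx : x ∈ pathDomain l) :
    x ∈ pathDomain (l.map (r.joint s)) ∧ pathMap (l.map (r.joint s)) x = pathMap l x := by
  induction l generalizing x with
  | nil => exact ⟨hx, rfl⟩
  | cons a l ih =>
    have h := ih hx.2
    have h1 := real_joint r s a hx.1
    rw [h1] at h
    refine ⟨⟨source_joint r s a hx.1, h.1⟩, ?_⟩
    simp only [List.map_cons, pathMap, Function.comp_apply]
    rw [h.2, h1]

/-- Uniqueness of lifts: at each step the current point lies in the source of at most one lift of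
the next edge, and this lift determines the next point. -/
theorem eq_of_mem_pathDomain {l₁ l₂ : List (JointEdge F' G')}
    (h : l₁.map (r.joint s) = l₂.map (r.joint s)) {x : Space}
    (h₁ : x ∈ pathDomain l₁) (h₂ : x ∈ pathDomain l₂) : l₁ = l₂ := by
  induction l₁ generalizing l₂ x with
  | nil => exact (List.map_eq_nil_iff.1 h.symm).symm
  | cons a l₁ ih =>
    cases l₂ with
    | nil => simp at h
    | cons b l₂ =>
      simp only [List.map_cons, List.cons.injEq] at h
      obtain rfl := joint_eq_of_mem r s h.1 h₁.1 h₂.1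
      rw [ih h.2 h₁.2 h₂.2]

/-- Existence of lifts almost everywhere: a point fails to lift either at the first edge or, after
it, along the tail. Both sets are null, the second because it is the preimage of a null set under a
non-singular map. -/
theorem pathDomain_cover (l : List (JointEdge F G)) :
    lam {x | x ∈ pathDomain l ∧ ∀ l', l'.map (r.joint s) = l → x ∉ pathDomain l'} = 0 := by
  induction l with
  | nil =>
    refine measure_mono_null (fun x hx => ?_) (measure_empty (μ := lam))
    exact hx.2 [] rfl (mem_univ x)
  | cons a l ih =>
    have hns : Nonsingular lam a.real := nonsingular_pathMap [a]
    -- The image of the preimage lies in the null set, so the preimage is null; injectivity plays no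
    -- role.
    have h2 : lam (a.real ⁻¹' {x | x ∈ pathDomain l ∧
        ∀ l', l'.map (r.joint s) = l → x ∉ pathDomain l'}) = 0 :=
      (hns.image_null_iff _).1 (measure_mono_null (image_preimage_subset _ _) ih)
    refine measure_mono_null (fun x hx => ?_) (measure_union_null (joint_cover r s a) h2)
    by_contra hcon
    simp only [mem_union, mem_ofPred_eq, mem_preimage, not_or, not_and, not_forall, not_not,
      exists_prop] at hcon
    obtain ⟨a', ha', hxa⟩ := hcon.1 hx.1.1
    obtain ⟨l', hl', hxl⟩ := hcon.2 hx.1.2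
    refine hx.2 (a' :: l') (by rw [List.map_cons, ha', hl']) ⟨hxa, ?_⟩
    rw [mem_preimage, real_joint r s a' hxa, ha']
    exact hxl

end Refinement

/-! ### Concatenation and rotation of paths -/

section Paths

variable {Ω : Type u} {V W : Set Space} {F : Graphing Ω V} {G : Graphing Ω W}

theorem pathMap_append (l₁ l₂ : List (JointEdge F G)) (x : Space) :
    pathMap (l₁ ++ l₂) x = pathMap l₂ (pathMap l₁ x) := by
  induction l₁ generalizing x with
  | nil => rfl
  | cons a l₁ ih => exact ih _

theorem mem_pathDomain_append (l₁ l₂ : List (JointEdge F G)) (x : Space) :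
    x ∈ pathDomain (l₁ ++ l₂) ↔ x ∈ pathDomain l₁ ∧ pathMap l₁ x ∈ pathDomain l₂ := by
  induction l₁ generalizing x with
  | nil => exact ⟨fun h => ⟨mem_univ x, h⟩, fun h => h.2⟩
  | cons a l₁ ih =>
    simp only [List.cons_append, pathDomain, mem_inter_iff, mem_preimage, ih, pathMap,
      Function.comp_apply, and_assoc]

/-- Both `l.take d` and `l.drop d` are loops at `x`, so they can be followed in either order. -/
theorem mem_pathDomain_rotate {l : List (JointEdge F G)} {d : ℕ} (hd : d ≤ l.length) {x : Space}
    (hx : x ∈ pathDomain l) (hl : pathMap l x = x) (ht : pathMap (l.take d) x = x) :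
    x ∈ pathDomain (l.rotate d) := by
  rw [← List.take_append_drop d l, mem_pathDomain_append, ht] at hx
  rw [← List.take_append_drop d l, pathMap_append, ht] at hl
  rw [List.rotate_eq_drop_append_take hd, mem_pathDomain_append, hl]
  exact ⟨hx.2, hx.1⟩

end Paths

/-! ### Invariance of the measurement and of the execution -/

namespace Refinement

variable {Ω : Type u} {V W : Set Space} {F' F : Graphing Ω V} {G' G : Graphing Ω W}
  (r : Refinement F' F) (s : Refinement G' G)

/-- A projected cycle may be a power when its lift is not, so the condition on repetitions is a
priori stronger downstairs. It only matters at points whose orbit closes up early, and there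
uniqueness of lifts makes the lift a power as well. -/
theorem cycleSet_eq (l : List (JointEdge F' G')) :
    cycleSet l = pathDomain l ∩ cycleSet (l.map (r.joint s)) := by
  ext x
  constructor
  · rintro ⟨hx, hl, hd⟩
    obtain ⟨h1, h2⟩ := pathDomain_map_and_pathMap_map r s l hx
    refine ⟨hx, h1, h2.trans hl, fun d hd0 hdl hrot heq => ?_⟩
    rw [List.length_map] at hdl
    have hxd : x ∈ pathDomain (l.take d) := by
      rw [← List.take_append_drop d l, mem_pathDomain_append] at hx
      exact hx.1
    rw [← List.map_take, (pathDomain_map_and_pathMap_map r s _ hxd).2] at heq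
    refine hd d hd0 hdl ?_ heq
    -- As the orbit is back at `x` after `d` steps, `x` lies in the domains of both `l.rotate d` and
    -- `l`, two lifts of the same path; hence they are equal.
    refine eq_of_mem_pathDomain r s ?_ (mem_pathDomain_rotate hdl.le hx hl heq) hx
    rw [List.map_rotate, hrot]
  · rintro ⟨hx, -, hl, hd⟩
    refine ⟨hx, (pathDomain_map_and_pathMap_map r s l hx).2 ▸ hl, fun d hd0 hdl hrot heq => ?_⟩
    have hxd : x ∈ pathDomain (l.take d) := by
      rw [← List.take_append_drop d l, mem_pathDomain_append] at hx
      exact hx.1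
    refine hd d hd0 (by rwa [List.length_map]) (by rw [← List.map_rotate, hrot]) ?_
    rw [← List.map_take, (pathDomain_map_and_pathMap_map r s _ hxd).2, heq]

theorem tsum_lam_cycleSet (l : List (JointEdge F G)) :
    ∑' l' : {l' : List (JointEdge F' G') // l'.map (r.joint s) = l}, lam (cycleSet l'.1) =
      lam (cycleSet l) := by
  have := F'.dialect_finite
  have := G'.dialect_finite
  have := F'.edge_countable
  have := G'.edge_countable
  -- Restricting `lam` to `cycleSet l` puts measurability on the path domains alone: additivity
  -- needs nothing about `cycleSet l`.
  have h1 : ∀ l' : {l' : List (JointEdge F' G') // l'.map (r.joint s) = l},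
      lam (cycleSet l'.1) = lam.restrict (cycleSet l) (pathDomain l'.1) := by
    rintro ⟨l', rfl⟩
    rw [Measure.restrict_apply (measurableSet_pathDomain _), cycleSet_eq r s]
  rw [tsum_congr h1, ← measure_iUnion]
  · have hU := MeasurableSet.iUnion fun
      l' : {l' : List (JointEdge F' G') // l'.map (r.joint s) = l} => measurableSet_pathDomain l'.1
    rw [Measure.restrict_apply hU]
    refine le_antisymm (measure_mono inter_subset_right) ?_
    rw [← measure_inter_add_sdiff (cycleSet l) hU, inter_comm]
    refine le_of_eq ?_
    convert add_zero _ using 2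
    refine measure_mono_null (fun x hx => ?_) (pathDomain_cover r s l)
    exact ⟨hx.1.1, fun l' hl' hxl => hx.2 (mem_iUnion.2 ⟨⟨l', hl'⟩, hxl⟩)⟩
  · intro a b hab
    refine Set.disjoint_left.2 fun x ha hb => hab (Subtype.ext ?_)
    exact eq_of_mem_pathDomain r s (a.2.trans b.2.symm) ha hb
  · exact fun l' => measurableSet_pathDomain l'.1

/-- The measurement is invariant under refinement. -/
theorem meas_eq [Monoid Ω] (r : Refinement F' F) (s : Refinement G' G) (wt : Ω → ℝ≥0∞) :
    F'.meas G' wt = F.meas G wt := by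
  classical
  unfold Graphing.meas
  rw [Nat.card_congr r.dialect, Nat.card_congr s.dialect]
  congr 1
  -- Sum over the lifts of each coarse path separately; length, weight and being a cycle are
  -- constant on a fibre.
  rw [← (Equiv.sigmaFiberEquiv (List.map (r.joint s))).tsum_eq, ENNReal.tsum_sigma']
  refine tsum_congr fun l => ?_
  by_cases hl : IsAltCycle l
  · rw [if_pos hl, ← tsum_lam_cycleSet r s l, ← ENNReal.tsum_mul_left]
    refine tsum_congr ?_
    rintro ⟨l', rfl⟩
    rw [pathWeight_map, List.length_map]
    exact if_pos ((isAltCycle_map r s l').1 hl)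
  · rw [if_neg hl]
    refine ENNReal.tsum_eq_zero.2 ?_
    rintro ⟨l', rfl⟩
    exact if_neg fun h => hl ((isAltCycle_map r s l').2 h)

/-- The execution of refinements is a refinement of the execution. -/
def exec [Monoid Ω] : Refinement (F'.exec G') (F.exec G) where
  edge l := ⟨l.1.map (r.joint s), (isAltPath_map r s l.1).2 l.2⟩
  dialect := r.dialect.prodCongr s.dialect
  weight_eq l := (pathWeight_map r s l.1).symm
  src_eq l := by
    simp only [Graphing.exec, List.head_map]
    exact (src_joint r s _).symm
  tgt_eq l := by
    simp only [Graphing.exec, List.getLast_map]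
    exact (tgt_joint r s _).symm
  source_subset l := by
    rintro x ⟨hx, h1, h2⟩
    obtain ⟨h3, h4⟩ := pathDomain_map_and_pathMap_map r s l.1 hx
    exact ⟨h3, h1, by rwa [h4]⟩
  real_eqOn l := fun x hx => (pathDomain_map_and_pathMap_map r s l.1 hx.1).2.symm
  eq_of_mem l₁ l₂ h x h₁ h₂ :=
    Subtype.ext (eq_of_mem_pathDomain r s (Subtype.ext_iff.1 h) h₁.1 h₂.1)
  cover l := by
    refine measure_mono_null ?_ (pathDomain_cover r s l.1)
    rintro x ⟨⟨hx, h1, h2⟩, h3⟩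
    refine ⟨hx, fun l' hl' hxl => ?_⟩
    refine h3 ⟨l', (isAltPath_map r s l').1 (hl' ▸ l.2)⟩ (Subtype.ext hl') ⟨hxl, h1, ?_⟩
    rwa [← (pathDomain_map_and_pathMap_map r s l' hxl).2, hl']

end Refinement

/-! ## Compilation of graphings -/

/-- A graphing in `m` has a refinement in `n` when `m` is compilable in `n`. -/
theorem Graphing.IsIn.exists_refinement {Ω : Type u} {V : Set Space} {F : Graphing Ω V}
    {m n : Microcosm lam} (hF : F.IsIn m) (hmn : m.Compilable n) :
    ∃ F' : Graphing Ω V, F'.IsIn n ∧ Nonempty (Refinement F' F) := by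
  choose g hg hFg using hF
  choose k P h hP hdisj hcov hh using fun e => hmn (g e) (hg e)
  have hnull : ∀ e i, lam {x | ¬ (x ∈ P e i → g e x = h e i x)} = 0 := fun e i =>
    ae_iff.1 ((ae_restrict_iff' (hP e i)).1 (hh e i).2)
  -- A measurable null hull of the set of disagreement: removing it keeps the new sources measurable
  -- and makes the realisations agree at every remaining point.
  let N : ∀ e, Fin (k e) → Set Space := fun e i =>
    toMeasurable lam {x | ¬ (x ∈ P e i → g e x = h e i x)}
  have hN : ∀ e i, lam (N e i) = 0 := fun e i => (measure_toMeasurable _).trans (hnull e i)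
  let S : (Σ e, Fin (k e)) → Set Space := fun q => (F.source q.1 ∩ P q.1 q.2) \ N q.1 q.2
  have hS : ∀ q, MeasurableSet (S q) := fun q =>
    ((F.measurableSet_source q.1).inter (hP q.1 q.2)).diff (measurableSet_toMeasurable _ _)
  have hns : ∀ q : Σ e, Fin (k e), Nonsingular lam (h q.1 q.2) := fun q =>
    n.nonsingular _ (hh q.1 q.2).1
  have hreal : ∀ q : Σ e, Fin (k e), EqOn (h q.1 q.2) (F.real q.1) (S q) := by
    rintro ⟨e, i⟩ x ⟨⟨hx, hxP⟩, hxN⟩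
    have : g e x = h e i x := by
      by_contra hne
      exact hxN (subset_toMeasurable _ _ fun himp => hne (himp hxP))
    rw [hFg e hx]
    exact this.symm
  have := F.edge_countable
  let F' : Graphing Ω V :=
    { Dialect := F.Dialect
      dialect_finite := F.dialect_finite
      dialect_nonempty := F.dialect_nonempty
      Edge := Σ e, Fin (k e)
      edge_countable := inferInstance
      weight := fun q => F.weight q.1
      source := S
      real := fun q => h q.1 q.2
      src := fun q => F.src q.1
      tgt := fun q => F.tgt q.1
      measurableSet_carrier := F.measurableSet_carrier
      nonsingular_real := hns
      measurableSet_source := hS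
      nullMeasurableSet_target := fun q => (hns q).nullMeasurableSet_image (hS q)
      source_subset := fun q x hx => F.source_subset q.1 hx.1.1
      target_subset := by
        rintro q _ ⟨x, hx, rfl⟩
        refine F.target_subset q.1 ⟨x, hx.1.1, ?_⟩
        exact (hreal q hx).symm }
  refine ⟨F', fun q => ⟨h q.1 q.2, (hh q.1 q.2).1, fun _ _ => rfl⟩, ⟨?_⟩⟩
  exact
    { edge := fun q => q.1
      dialect := Equiv.refl _
      weight_eq := fun _ => rfl
      src_eq := fun _ => rfl
      tgt_eq := fun _ => rfl
      source_subset := fun q x hx => hx.1.1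
      real_eqOn := hreal
      eq_of_mem := by
        rintro ⟨e, i⟩ ⟨e', j⟩ hij x hx hx'
        obtain rfl : e = e' := hij
        by_contra hne
        have hij' : i ≠ j := fun h => hne (by rw [h])
        exact Set.disjoint_left.1 (hdisj e hij') hx.1.2 hx'.1.2
      cover := by
        intro e
        -- The pieces cover the space, so a point of the source is lost only if it lies in one of
        -- the removed hulls.
        refine measure_mono_null (fun x hx => ?_) (measure_iUnion_null fun i => hN e i)
        have hxu : x ∈ ⋃ i, P e i := by
          rw [hcov e]
          exact mem_univ x
        obtain ⟨i, hi⟩ := mem_iUnion.1 hxu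
        refine mem_iUnion.2 ⟨i, ?_⟩
        by_contra hxN
        exact hx.2 ⟨e, i⟩ rfl ⟨⟨hx.1, hi⟩, hxN⟩ }

/-! ## Refinements of projects -/

namespace Project

variable {Ω : Type u}

/-- The project `a` with the graphings of its slices replaced. -/
def replace (a : Project Ω) (G : a.Slice → Graphing Ω a.carrier) : Project Ω :=
  { a with graphing := G }

variable [Monoid Ω] (wt : Ω → ℝ≥0∞) (a b : Project Ω) {G : a.Slice → Graphing Ω a.carrier}

theorem pairing_replace_left (r : ∀ i, Refinement (G i) (a.graphing i)) :
    pairing wt (a.replace G) b = pairing wt a b := by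
  have h : ∀ i j, (G i).meas (b.graphing j) wt = (a.graphing i).meas (b.graphing j) wt :=
    fun i j => (r i).meas_eq (Refinement.refl _) wt
  simp only [pairing, replace, h]
  rfl

theorem pairing_replace_right (r : ∀ i, Refinement (G i) (a.graphing i)) :
    pairing wt b (a.replace G) = pairing wt b a := by
  have h : ∀ i j, (b.graphing j).meas (G i) wt = (b.graphing j).meas (a.graphing i) wt :=
    fun i j => (Refinement.refl _).meas_eq (r i) wt
  simp only [pairing, replace, h]
  rfl

/-- The wager of an execution is a pairing, hence unchanged, so only the graphings of the slices are
replaced. -/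
theorem exec_replace (r : ∀ i, Refinement (G i) (a.graphing i)) :
    (a.replace G).exec wt b =
      (a.exec wt b).replace fun i => (G i.1).exec (b.graphing i.2) := by
  unfold exec
  rw [pairing_replace_left wt a b r]
  rfl

theorem orthogonal_replace_left (r : ∀ i, Refinement (G i) (a.graphing i)) :
    (a.replace G).Orthogonal wt b ↔ a.Orthogonal wt b := by
  unfold Orthogonal
  rw [pairing_replace_left wt a b r]
  rfl

theorem orthogonal_replace_right (r : ∀ i, Refinement (G i) (a.graphing i)) :
    b.Orthogonal wt (a.replace G) ↔ b.Orthogonal wt a := by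
  unfold Orthogonal
  rw [pairing_replace_right wt a b r]
  rfl

variable {a}

theorem IsOfKind.replace {κ : Kind Ω} (ha : a.IsOfKind κ)
    (r : ∀ i, Refinement (G i) (a.graphing i)) : (a.replace G).IsOfKind κ :=
  fun i => (r i).isOfKind (ha i)

end Project

/-! ### Invariance of types, languages and complexity classes -/

section Types

variable {Ω : Type u} [Monoid Ω] {wt : Ω → ℝ≥0∞} {κ : Kind Ω}

/-- An orthogonal is defined by a kind and by pairings, both stable under refinement, whatever the
set `A` is. -/
theorem orth_replace_mem {V : Set Space} {A : Set (Project Ω)} {a : Project Ω}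
    (ha : a ∈ orth wt κ V A) {G : a.Slice → Graphing Ω a.carrier}
    (r : ∀ i, Refinement (G i) (a.graphing i)) : a.replace G ∈ orth wt κ V A :=
  ⟨ha.1, ha.2.1.replace r, fun b hb =>
    (Project.orthogonal_replace_right wt a b r).2 (ha.2.2 b hb)⟩

/-- A type is its own bi-orthogonal, hence an orthogonal. -/
theorem IsConduct.replace_mem {V : Set Space} {A : Set (Project Ω)} (hA : IsConduct wt κ V A)
    {a : Project Ω} (ha : a ∈ A) {G : a.Slice → Graphing Ω a.carrier}
    (r : ∀ i, Refinement (G i) (a.graphing i)) : a.replace G ∈ A := by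
  rw [← hA.2] at ha ⊢
  exact orth_replace_mem ha r

/-- Executing the refined project against `a` refines the original result, which lies in `B`; only
the closure of `B` under refinement is needed. -/
theorem lolli_replace_mem {V W : Set Space} {A B : Set (Project Ω)} (hB : IsConduct wt κ W B)
    {f : Project Ω} (hf : f ∈ lolli wt κ V W A B) {G : f.Slice → Graphing Ω f.carrier}
    (r : ∀ i, Refinement (G i) (f.graphing i)) : f.replace G ∈ lolli wt κ V W A B := by
  refine ⟨hf.1, hf.2.1.replace r, fun a ha => ?_⟩
  rw [Project.exec_replace wt f a r]
  exact hB.replace_mem (hf.2.2 a ha) fun i => (r i.1).exec (Refinement.refl _)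

theorem language_replace {α : Type*} (loc : Option α × Port ↪ ℤ) (T : Set (Project Ω))
    (P : Project Ω) {G : P.Slice → Graphing Ω P.carrier}
    (r : ∀ i, Refinement (G i) (P.graphing i)) :
    language loc wt T (P.replace G) = language loc wt T P := by
  ext w
  refine forall₂_congr fun t _ => ?_
  rw [Project.exec_replace wt P _ r]
  exact Project.orthogonal_replace_left wt _ t fun i => (r i.1).exec (Refinement.refl _)

theorem complexityClass_mono {α : Type*} (loc : Option α × Port ↪ ℤ) {W : Set Space}
    {B : Set (Project Ω)} (hB : IsConduct wt κ W B) (T : Set (Project Ω)) {m n : Microcosm lam}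
    (hmn : m.Compilable n) :
    complexityClass loc wt κ W B T m ⊆ complexityClass loc wt κ W B T n := by
  rintro L ⟨P, hP, hPm, rfl⟩
  choose G hG r using fun i => (hPm i).exists_refinement hmn
  have r' := fun i => (r i).some
  exact ⟨P.replace G, lolli_replace_mem hB hP r', hG, language_replace loc T P r'⟩

end Types

end

end Microcosmos

theorem mainTheorem7 {Ω : Type*} [Monoid Ω] (wt : Ω → ENNReal) (κ : Microcosmos.Kind Ω)
    {α : Type*} [Finite α] (loc : Option α × Microcosmos.Port ↪ ℤ)
    (W : Set Microcosmos.Space) (hW : Disjoint (Microcosmos.wordCarrier loc) W)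
    (B : Set (Microcosmos.Project Ω)) (hB : Microcosmos.IsConduct wt κ W B)
    (T : Set (Microcosmos.Project Ω)) :
    (∀ m n : Microcosmos.Microcosm Microcosmos.lam, m.Compilable n →
      Microcosmos.complexityClass loc wt κ W B T m ⊆
        Microcosmos.complexityClass loc wt κ W B T n) ∧
    (∀ m n : Microcosmos.Microcosm Microcosmos.lam, m.CompEquiv n →
      Microcosmos.complexityClass loc wt κ W B T m =
        Microcosmos.complexityClass loc wt κ W B T n) :=
  ⟨fun _ _ h => Microcosmos.complexityClass_mono loc hB T h, fun _ _ h =>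
    (Microcosmos.complexityClass_mono loc hB T h.1).antisymm
      (Microcosmos.complexityClass_mono loc hB T h.2)⟩
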